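/- Let Alice hold $\mathbb{C}^2$ with orthonormal basis $|0\rangle,|1\rangle$ and let Bob hold two qubits, $\mathbb{C}^4=\mathbb{C}^2\otimes\mathbb{C}^2$, with orthonormal basis $|\mathbf 0\rangle=|00\rangle$, $|\mathbf 1\rangle=|01\rangle$, $|\mathbf 2\rangle=|10\rangle$, $|\mathbf 3\rangle=|11\rangle$. Consider the (unnormalized) vectors of $\mathbb{C}^2\otimes\mathbb{C}^4$ $$|\psi_1\rangle=|0\mathbf 0\rangle+|0\mathbf 2\rangle+|1\mathbf 1\rangle-|1\mathbf 3\rangle,\quad |\psi_2\rangle=|0\mathbf 0\rangle-|0\mathbf 2\rangle-|1\mathbf 1\rangle-|1\mathbf 3\rangle,\quad |\psi_3\rangle=|0\mathbf 1\rangle-|1\mathbf 2\rangle-|1\mathbf 0\rangle-|0\mathbf 3\rangle .$$ A family of states is called locally distinguishable if some LOCC protocol (a finite adaptive sequence of local measurements by Alice or Bob, with arbitrary Kraus operators and broadcast outcomes, followed by the announcement of a label) identifies, for each input from the family, that input with probability one. An orthogonal family has local redundancy if there is a nonempty proper subset of the subsystems (here: Alice's qubit and Bob's two qubits) such that the reduced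 states obtained by discarding it are still mutually orthogonal. An orthogonal family has genuine activable nonlocality if it is locally distinguishable, has no local redundancy, and there is a local measurement by one of the parties, not all of whose effects are proportional to the identity, such that for each outcome the post-measurement states of all members of the family are nonzero, mutually orthogonal and together not locally distinguishable. Then: 1. $\psi_1,\psi_2,\psi_3$ are nonzero and mutually orthogonal, they have no local redundancy, and they are locally distinguishable. 2. Let $P_{\mathbf{01}}=|\mathbf 0\rangle\langle\mathbf 0|+|\mathbf 1\rangle\langle\mathbf 1|$ and $P_{\mathbf{23}}=|\mathbf 2\rangle\langle\mathbf 2|+|\mathbf 3\rangle\langle\mathbf 3|$. Bob's projective measurement $\{P_{\mathbf{01}},P_{\mathbf{23}}\}$ turns $\psi_1,\psi_2,\psi_3$ into $|0\mathbf 0\rangle+|1\mathbf 1\rangle$, $|0\mathbf 0\rangle-|1\mathbf 1\rangle$, $|0\mathbf 1\rangle-|1\mathbf 0\rangle$ respectively for the outcome $P_{\mathbf{01}}$, and into $|0\mathbf 2\rangle-|1\mathbf 3\rangle$, $-(|0\mathbf 2\rangle+|1\mathbf 3\rangle)$, $-(|1\mathbf 2\rangle+|0\mathbf 3\rangle)$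 for the outcome $P_{\mathbf{23}}$. For either outcome these are three nonzero, mutually orthogonal, entangled vectors in a common subspace $U\otimes W$ with $\dim U=\dim W=2$, and the three are not locally distinguishable. 3. Consequently $\{\psi_1,\psi_2,\psi_3\}$ has genuine activable nonlocality. -/

import Mathlib

open scoped Matrix Kronecker

/-- Vectors (possibly unnormalized pure states) of the bipartite system `ℂ^m ⊗ ℂ^n`, given by
their coordinates in the product basis `|a⟩ ⊗ |b⟩`; Alice holds `ℂ^m` and Bob holds `ℂ^n`. -/
abbrev BipartiteVec (m n : ℕ) : Type := Fin m × Fin n → ℂ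

/-- The squared Hilbert space norm `⟨ψ|ψ⟩`. -/
noncomputable def vecNormSq {m n : ℕ} (ψ : BipartiteVec m n) : ℝ := ∑ x, ‖ψ x‖ ^ 2

/-- `⟨ψ i|ψ j⟩ = 0` for all `i ≠ j`. -/
def PairwiseOrthogonal {N m n : ℕ} (ψ : Fin N → BipartiteVec m n) : Prop :=
  ∀ i j, i ≠ j → star (ψ i) ⬝ᵥ ψ j = 0

/-- The action of `A ⊗ 1`, for a local operator `A` of Alice. -/
noncomputable def aliceAct {m m' n : ℕ} (A : Matrix (Fin m') (Fin m) ℂ)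
    (ψ : BipartiteVec m n) : BipartiteVec m' n :=
  (A ⊗ₖ (1 : Matrix (Fin n) (Fin n) ℂ)) *ᵥ ψ

/-- The action of `1 ⊗ B`, for a local operator `B` of Bob. -/
noncomputable def bobAct {m n n' : ℕ} (B : Matrix (Fin n') (Fin n) ℂ)
    (ψ : BipartiteVec m n) : BipartiteVec m n' :=
  ((1 : Matrix (Fin m) (Fin m) ℂ) ⊗ₖ B) *ᵥ ψ

/-- `φ` is entangled: it is not a product vector `a ⊗ b`. -/
def IsEntangledVec {m n : ℕ} (φ : BipartiteVec m n) : Prop :=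
  ¬ ∃ (a : Fin m → ℂ) (b : Fin n → ℂ), φ = fun x => a x.1 * b x.2

/-- All the vectors `φ i` lie in one and the same subspace of the form `range V ⊗ range W`,
where `V : ℂ² → ℂ^m` and `W : ℂ² → ℂ^n` are isometries. -/
def LieInTwoQubitSubspace {N m n : ℕ} (φ : Fin N → BipartiteVec m n) : Prop :=
  ∃ (V : Matrix (Fin m) (Fin 2) ℂ) (W : Matrix (Fin n) (Fin 2) ℂ),
    Vᴴ * V = 1 ∧ Wᴴ * W = 1 ∧ ∀ i, ∃ χ : BipartiteVec 2 2, φ i = (V ⊗ₖ W) *ᵥ χ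

/-! ### LOCC protocols and local distinguishability -/

/-- (Finite) LOCC protocols on `ℂ^m ⊗ ℂ^n` whose final output is a label in `Fin N`.
Either the protocol stops and announces a label, or one of the parties performs a quantum
measurement with Kraus operators `K k`, the outcome `k` is broadcast, and the protocol goes on in
a way that may depend on `k` (hence on all earlier outcomes). The dimension of the
output system of a Kraus operator is arbitrary, so that local ancillas, local isometries, the
discarding of local subsystems and local or shared randomness are all included. -/
inductive LOCCProtocol (N : ℕ) : ℕ → ℕ → Type
  | announce {m n : ℕ} (i : Fin N) : LOCCProtocol N m n
  | alice {m n : ℕ} (r : ℕ) (d : Fin r → ℕ) (K : (k : Fin r) → Matrix (Fin (d k)) (Fin m) ℂ)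
      (complete : ∑ k, (K k)ᴴ * K k = 1) (next : (k : Fin r) → LOCCProtocol N (d k) n) :
      LOCCProtocol N m n
  | bob {m n : ℕ} (r : ℕ) (d : Fin r → ℕ) (K : (k : Fin r) → Matrix (Fin (d k)) (Fin n) ℂ)
      (complete : ∑ k, (K k)ᴴ * K k = 1) (next : (k : Fin r) → LOCCProtocol N m (d k)) :
      LOCCProtocol N m n

/-- The weight with which the protocol announces `j` on the input `ψ`: for a unit vector `ψ` it is
the probability of the output `j`; in general it is that probability times `⟨ψ|ψ⟩`. -/
noncomputable def LOCCProtocol.weight {N : ℕ} :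
    {m n : ℕ} → LOCCProtocol N m n → BipartiteVec m n → Fin N → ℝ
  | _, _, .announce i, ψ, j => if i = j then vecNormSq ψ else 0
  | _, _, .alice _ _ K _ next, ψ, j => ∑ k, (next k).weight (aliceAct (K k) ψ) j
  | _, _, .bob _ _ K _ next, ψ, j => ∑ k, (next k).weight (bobAct (K k) ψ) j

/-- Perfect distinguishability by LOCC: some LOCC protocol, on each input `ψ i`,
announces `i` with probability one. -/
def LocallyDistinguishable {N m n : ℕ} (ψ : Fin N → BipartiteVec m n) : Prop :=
  ∃ P : LOCCProtocol N m n, ∀ i, P.weight (ψ i) i = vecNormSq (ψ i)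

/-! ### Local redundancy -/

section Redundancy

/-- The basis label of the whole system whose part outside `D` is `x` and whose part
in `D` is `z`. -/
def glueLabels {S : Type} [DecidableEq S] {d : S → ℕ} (D : Finset S)
    (x : (s : {s // s ∉ D}) → Fin (d s)) (z : (s : {s // s ∈ D}) → Fin (d s)) :
    (s : S) → Fin (d s) :=
  fun s => if h : s ∈ D then z ⟨s, h⟩ else x ⟨s, h⟩

/-- The partial trace of `|ψ⟩⟨ψ|` over the subsystems in `D`, for a vector `ψ` of a system
composed of subsystems `ℂ^(d s)`, `s ∈ S`. -/
noncomputable def reducedState {S : Type} [DecidableEq S] {d : S → ℕ} (D : Finset S)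
    (ψ : ((s : S) → Fin (d s)) → ℂ) :
    Matrix ((s : {s // s ∉ D}) → Fin (d s)) ((s : {s // s ∉ D}) → Fin (d s)) ℂ :=
  fun x y => ∑ z : (s : {s // s ∈ D}) → Fin (d s),
    ψ (glueLabels D x z) * star (ψ (glueLabels D y z))

/-- Local redundancy, with respect to a decomposition `e` of the whole system into subsystems
`ℂ^(d s)`, `s ∈ S`: one can discard one or more subsystems, but not all of them, such that the
reduced states are still mutually orthogonal, that is `tr (ρ i * ρ j) = 0` for `i ≠ j`. -/
def HasLocalRedundancy {N m n : ℕ} {S : Type} [Fintype S] [DecidableEq S] {d : S → ℕ}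
    (e : Fin m × Fin n ≃ ((s : S) → Fin (d s))) (ψ : Fin N → BipartiteVec m n) : Prop :=
  ∃ D : Finset S, D.Nonempty ∧ D ≠ Finset.univ ∧
    ∀ i j, i ≠ j →
      (reducedState D (fun x => ψ i (e.symm x)) *
        reducedState D (fun x => ψ j (e.symm x))).trace = 0

end Redundancy

/-! ### Local measurements and activation -/

/-- A quantum measurement on `ℂ^d`, given by its measurement operators. -/
structure LocalMeasurement (d : ℕ) where
  outcomes : ℕ
  K : Fin outcomes → Matrix (Fin d) (Fin d) ℂ
  complete : ∑ k, (K k)ᴴ * K k = 1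

/-- Not all the effects of the measurement are proportional to the identity. -/
def LocalMeasurement.Nontrivial {d : ℕ} (M : LocalMeasurement d) : Prop :=
  ¬ ∀ k, ∃ c : ℂ, (M.K k)ᴴ * M.K k = c • (1 : Matrix (Fin d) (Fin d) ℂ)

/-- The vectors are nonzero, mutually orthogonal, and not perfectly distinguishable by LOCC. -/
def IsLocallyIndistinguishableOrthogonalSet {N m n : ℕ} (φ : Fin N → BipartiteVec m n) : Prop :=
  (∀ i, φ i ≠ 0) ∧ PairwiseOrthogonal φ ∧ ¬ LocallyDistinguishable φ

/-- Genuine activable nonlocality of a set of orthogonal states: it is locally distinguishable and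
has no local redundancy, but a nontrivial measurement of one of the parties transforms it, for
each of the outcomes, into a locally indistinguishable set of orthogonal states of the
same cardinality. -/
def HasGenuineActivableNonlocality {N m n : ℕ} {S : Type} [Fintype S] [DecidableEq S] {d : S → ℕ}
    (e : Fin m × Fin n ≃ ((s : S) → Fin (d s))) (ψ : Fin N → BipartiteVec m n) : Prop :=
  (∀ i, ψ i ≠ 0) ∧ PairwiseOrthogonal ψ ∧ ¬ HasLocalRedundancy e ψ ∧ LocallyDistinguishable ψ ∧
    ((∃ M : LocalMeasurement m, M.Nontrivial ∧
        ∀ k, IsLocallyIndistinguishableOrthogonalSet (fun i => aliceAct (M.K k) (ψ i))) ∨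
      (∃ M : LocalMeasurement n, M.Nontrivial ∧
        ∀ k, IsLocallyIndistinguishableOrthogonalSet (fun i => bobAct (M.K k) (ψ i))))

/-! ### The three states in `ℂ² ⊗ ℂ⁴` -/

/-- The product basis vector `|a b⟩` of `ℂ² ⊗ ℂ⁴`. -/
def ket (a : Fin 2) (b : Fin 4) : BipartiteVec 2 4 := Pi.single (a, b) 1

/-- The three unnormalized states. -/
noncomputable def exampleStates : Fin 3 → BipartiteVec 2 4 :=
  ![ket 0 0 + ket 0 2 + ket 1 1 - ket 1 3,
    ket 0 0 - ket 0 2 - ket 1 1 - ket 1 3,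
    ket 0 1 - ket 1 2 - ket 1 0 - ket 0 3]

/-- The decomposition of `ℂ² ⊗ ℂ⁴` into three qubits: subsystem `0` is the qubit of Alice, and
subsystems `1` and `2` are the two qubits of Bob, where `|b₁ b₂⟩` is his basis vector
`|2 b₁ + b₂⟩`. -/
def qubitDecomposition : Fin 2 × Fin 4 ≃ ((_ : Fin 3) → Fin 2) where
  toFun x := ![x.1, ⟨x.2 / 2, by omega⟩, ⟨x.2 % 2, by omega⟩]
  invFun y := (y 0, ⟨2 * y 1 + y 2, by omega⟩)
  left_inv := by decide
  right_inv := by decide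

/-- The projector `|i⟩⟨i| + |j⟩⟨j|` of `ℂ⁴` (for `i ≠ j`). -/
def bobProj (i j : Fin 4) : Matrix (Fin 4) (Fin 4) ℂ :=
  Matrix.single i i 1 + Matrix.single j j 1

theorem bobProj_complete :
    ∑ k, (![bobProj 0 1, bobProj 2 3] k)ᴴ * ![bobProj 0 1, bobProj 2 3] k = 1 := by
  simp only [Fin.sum_univ_two, Matrix.cons_val_zero, Matrix.cons_val_one]
  ext i j
  fin_cases i <;> fin_cases j <;> simp [bobProj, Matrix.mul_apply, Matrix.single]

/-- The binary measurement of Bob with the projectors `P₀₁` (outcome `0`) and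
`P₂₃` (outcome `1`). -/
def bobMeasurement : LocalMeasurement 4 where
  outcomes := 2
  K := ![bobProj 0 1, bobProj 2 3]
  complete := bobProj_complete

/-! Vectors are identified with coefficient matrices, so Alice multiplies on the left by `K` and Bob
on the right by `Kᵀ`. Every post-measurement state is `X j * Wᵀ` with `X j` unitary and `W` an
isometry, i.e. maximally entangled in a two-qubit subspace. Along any LOCC branch the states keep
the form `A * X j * Bᵀ` with common `A`, `B`. By submultiplicativity of the Frobenius norm, an
announced label earns at most `‖A‖² ‖B‖²`, and Kraus completeness conserves the sum of this bound
over branches (`LOCCProtocol.sum_weight_le`). For `N` states in `ℂ^d ⊗ ℂ^d`, perfect discrimination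
would need `N * d ≤ d * d`, which fails for `N = 3`, `d = 2`. Before Bob's projection, an explicit
one-way protocol distinguishes the states. Local redundancy is excluded by a finite integer
computation. -/

/-! ### Frobenius norms and local operations on coefficient matrices. -/

/-- The squared Frobenius norm of a matrix. -/
noncomputable def frobeniusSq {m n : ℕ} (A : Matrix (Fin m) (Fin n) ℂ) : ℝ :=
  ∑ i, ∑ j, ‖A i j‖ ^ 2

/-- The bipartite vector whose coefficient matrix is `A`. -/
def matrixVec {m n : ℕ} (A : Matrix (Fin m) (Fin n) ℂ) : BipartiteVec m n := fun x => A x.1 x.2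

theorem vecNormSq_matrixVec {m n : ℕ} (A : Matrix (Fin m) (Fin n) ℂ) :
    vecNormSq (matrixVec A) = frobeniusSq A := by
  simp [vecNormSq, matrixVec, frobeniusSq, Fintype.sum_prod_type]

theorem trace_mul_conjTranspose_eq_frobeniusSq {m n : ℕ} (A : Matrix (Fin m) (Fin n) ℂ) :
    (A * Aᴴ).trace = (frobeniusSq A : ℂ) := by
  simp [frobeniusSq, Matrix.trace, Matrix.mul_apply, Complex.mul_conj, Complex.normSq_eq_norm_sq]

theorem trace_conjTranspose_mul_eq_frobeniusSq {m n : ℕ} (A : Matrix (Fin m) (Fin n) ℂ) :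
    (Aᴴ * A).trace = (frobeniusSq A : ℂ) := by
  rw [Matrix.trace_mul_comm, trace_mul_conjTranspose_eq_frobeniusSq]

theorem frobeniusSq_transpose {m n : ℕ} (A : Matrix (Fin m) (Fin n) ℂ) :
    frobeniusSq Aᵀ = frobeniusSq A := by
  simp only [frobeniusSq, Matrix.transpose_apply]
  exact Finset.sum_comm

theorem frobeniusSq_of_isometry {m n : ℕ} {V : Matrix (Fin m) (Fin n) ℂ} (hV : Vᴴ * V = 1) :
    frobeniusSq V = n := by
  have h := trace_conjTranspose_mul_eq_frobeniusSq V
  rw [hV, Matrix.trace_one, Fintype.card_fin] at h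
  exact_mod_cast h.symm

/-- Cauchy–Schwarz for each entry of the product. -/
theorem frobeniusSq_mul_le {l m n : ℕ} (A : Matrix (Fin l) (Fin m) ℂ)
    (B : Matrix (Fin m) (Fin n) ℂ) : frobeniusSq (A * B) ≤ frobeniusSq A * frobeniusSq B := by
  have key : ∀ i j, ‖(A * B) i j‖ ^ 2 ≤ (∑ k, ‖A i k‖ ^ 2) * ∑ k, ‖B k j‖ ^ 2 := fun i j => by
    refine le_trans ?_ (Finset.sum_mul_sq_le_sq_mul_sq _ _ _)
    gcongr
    rw [Matrix.mul_apply]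
    exact (norm_sum_le _ _).trans_eq (by simp)
  refine (Finset.sum_le_sum fun i _ => Finset.sum_le_sum fun j _ => key i j).trans_eq ?_
  rw [← frobeniusSq_transpose B]
  simp only [frobeniusSq, Matrix.transpose_apply, Finset.sum_mul_sum]

theorem frobeniusSq_isometry_mul {l m n : ℕ} {V : Matrix (Fin l) (Fin m) ℂ} (hV : Vᴴ * V = 1)
    (A : Matrix (Fin m) (Fin n) ℂ) : frobeniusSq (V * A) = frobeniusSq A := by
  have h : ((V * A)ᴴ * (V * A)).trace = (Aᴴ * A).trace := by
    rw [Matrix.conjTranspose_mul, Matrix.mul_assoc, ← Matrix.mul_assoc Vᴴ, hV, Matrix.one_mul]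
  simpa only [trace_conjTranspose_mul_eq_frobeniusSq, Complex.ofReal_inj] using h

theorem frobeniusSq_mul_coisometry {l m n : ℕ} (A : Matrix (Fin l) (Fin m) ℂ)
    {U : Matrix (Fin m) (Fin n) ℂ} (hU : U * Uᴴ = 1) : frobeniusSq (A * U) = frobeniusSq A := by
  have h : ((A * U) * (A * U)ᴴ).trace = (A * Aᴴ).trace := by
    rw [Matrix.conjTranspose_mul, Matrix.mul_assoc, ← Matrix.mul_assoc U, hU, Matrix.one_mul]
  simpa only [trace_mul_conjTranspose_eq_frobeniusSq, Complex.ofReal_inj] using h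

/-- Conservation of total weight under a measurement. It serves both parties, since Bob's operator
acts on the factor `B` from the left. -/
theorem sum_frobeniusSq_kraus_mul {m n r : ℕ} {d : Fin r → ℕ}
    (K : (k : Fin r) → Matrix (Fin (d k)) (Fin m) ℂ) (complete : ∑ k, (K k)ᴴ * K k = 1)
    (A : Matrix (Fin m) (Fin n) ℂ) : ∑ k, frobeniusSq (K k * A) = frobeniusSq A := by
  have h : ∑ k, ((K k * A)ᴴ * (K k * A)).trace = (Aᴴ * A).trace := by
    rw [← Matrix.trace_sum]
    simp_rw [Matrix.conjTranspose_mul, Matrix.mul_assoc, ← Matrix.mul_assoc (K _)ᴴ]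
    rw [← Matrix.mul_sum, ← Matrix.sum_mul, complete, Matrix.one_mul]
  simp only [trace_conjTranspose_mul_eq_frobeniusSq] at h
  exact_mod_cast h

theorem aliceAct_apply {m m' n : ℕ} (K : Matrix (Fin m') (Fin m) ℂ) (ψ : BipartiteVec m n)
    (a : Fin m') (b : Fin n) : aliceAct K ψ (a, b) = ∑ i, K a i * ψ (i, b) := by
  simp [aliceAct, Matrix.mulVec, dotProduct, Fintype.sum_prod_type, Matrix.one_apply]

theorem bobAct_apply {m n n' : ℕ} (K : Matrix (Fin n') (Fin n) ℂ) (ψ : BipartiteVec m n)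
    (a : Fin m) (b : Fin n') : bobAct K ψ (a, b) = ∑ i, K b i * ψ (a, i) := by
  simp [bobAct, Matrix.mulVec, dotProduct, Fintype.sum_prod_type, Matrix.one_apply]

theorem aliceAct_matrixVec {m m' n : ℕ} (K : Matrix (Fin m') (Fin m) ℂ)
    (A : Matrix (Fin m) (Fin n) ℂ) : aliceAct K (matrixVec A) = matrixVec (K * A) := by
  ext ⟨a, b⟩
  rw [aliceAct_apply]
  simp [matrixVec, Matrix.mul_apply]

theorem bobAct_matrixVec {m n n' : ℕ} (K : Matrix (Fin n') (Fin n) ℂ)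
    (A : Matrix (Fin m) (Fin n) ℂ) : bobAct K (matrixVec A) = matrixVec (A * Kᵀ) := by
  ext ⟨a, b⟩
  rw [bobAct_apply]
  simp [matrixVec, Matrix.mul_apply, mul_comm]

/-! ### The LOCC bound for maximally entangled states. -/

/-- The total weight with which an LOCC protocol identifies the members of a family of maximally
entangled states, transformed by local operators `A` and `B`, is at most `‖A‖² ‖B‖²`. -/
theorem LOCCProtocol.sum_weight_le {N d m n : ℕ} (P : LOCCProtocol N m n)
    (X : Fin N → Matrix (Fin d) (Fin d) ℂ) (hX : ∀ j, X j * (X j)ᴴ = 1)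
    (A : Matrix (Fin m) (Fin d) ℂ) (B : Matrix (Fin n) (Fin d) ℂ) :
    ∑ j, P.weight (matrixVec (A * X j * Bᵀ)) j ≤ frobeniusSq A * frobeniusSq B := by
  induction P with
  | announce i =>
    simp only [LOCCProtocol.weight, Finset.sum_ite_eq, Finset.mem_univ, if_true,
      vecNormSq_matrixVec]
    -- Only the announced label contributes, and the unitary `X i` does not change the norm of `A`.
    refine (frobeniusSq_mul_le _ _).trans_eq ?_
    rw [frobeniusSq_mul_coisometry A (hX i), frobeniusSq_transpose]
  | alice r d K complete next ih =>
    simp only [LOCCProtocol.weight]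
    rw [Finset.sum_comm, ← sum_frobeniusSq_kraus_mul K complete A, Finset.sum_mul]
    refine Finset.sum_le_sum fun k _ => ?_
    -- The outcome is absorbed into `A`; the `X j` are untouched.
    simpa only [aliceAct_matrixVec, Matrix.mul_assoc] using ih k (K k * A) B
  | bob r d K complete next ih =>
    simp only [LOCCProtocol.weight]
    rw [Finset.sum_comm, ← sum_frobeniusSq_kraus_mul K complete B, Finset.mul_sum]
    refine Finset.sum_le_sum fun k _ => ?_
    simpa only [bobAct_matrixVec, Matrix.mul_assoc, Matrix.transpose_mul] using ih k A (K k * B)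

/-- More than `d` maximally entangled states of a subspace `ℂ^d ⊗ ℂ^d` cannot be perfectly
distinguished by LOCC. -/
theorem not_locallyDistinguishable_of_maximallyEntangled {N d m n : ℕ} (hd : 0 < d) (hN : d < N)
    {V : Matrix (Fin m) (Fin d) ℂ} {W : Matrix (Fin n) (Fin d) ℂ}
    (hV : Vᴴ * V = 1) (hW : Wᴴ * W = 1)
    (X : Fin N → Matrix (Fin d) (Fin d) ℂ) (hX : ∀ j, X j * (X j)ᴴ = 1) :
    ¬ LocallyDistinguishable (fun j => matrixVec (V * X j * Wᵀ)) := by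
  rintro ⟨P, hP⟩
  have hnorm : ∀ j, vecNormSq (matrixVec (V * X j * Wᵀ)) = d := fun j => by
    have hX' : (X j)ᴴ * X j = 1 := mul_eq_one_comm.mp (hX j)
    rw [vecNormSq_matrixVec, Matrix.mul_assoc, frobeniusSq_isometry_mul hV,
      frobeniusSq_isometry_mul hX', frobeniusSq_transpose, frobeniusSq_of_isometry hW]
  have h := P.sum_weight_le X hX V W
  simp only [hP, hnorm, frobeniusSq_of_isometry hV, frobeniusSq_of_isometry hW,
    Finset.sum_const, Finset.card_univ, Fintype.card_fin, nsmul_eq_mul] at h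
  -- Each state, and each of the isometries `V` and `W`, has squared norm `d`.
  have h' : N * d ≤ d * d := by exact_mod_cast h
  exact absurd (Nat.le_of_mul_le_mul_right h' hd) (not_le.mpr hN)

/-- A vector with a nonzero `2 × 2` minor of its coefficient matrix is entangled. -/
theorem isEntangledVec_of_minor_ne_zero {m n : ℕ} {φ : BipartiteVec m n} (a a' : Fin m)
    (b b' : Fin n) (h : φ (a, b) * φ (a', b') - φ (a, b') * φ (a', b) ≠ 0) :
    IsEntangledVec φ := by
  rintro ⟨u, v, rfl⟩
  exact h (by ring)

/-! ### The three states: orthogonality and absence of local redundancy. -/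

/-- The integer coefficients of the three states. -/
def exampleCoeff : Fin 3 → Matrix (Fin 2) (Fin 4) ℤ :=
  ![!![1, 0, 1, 0; 0, 1, 0, -1], !![1, 0, -1, 0; 0, -1, 0, -1], !![0, 1, 0, -1; -1, 0, -1, 0]]

theorem exampleStates_apply (i : Fin 3) (x : Fin 2 × Fin 4) :
    exampleStates i x = (exampleCoeff i x.1 x.2 : ℂ) := by
  obtain ⟨a, b⟩ := x
  fin_cases i <;> fin_cases a <;> fin_cases b <;>
    simp [exampleStates, exampleCoeff, ket]

theorem exampleStates_ne_zero (i : Fin 3) : exampleStates i ≠ 0 := by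
  intro h
  have h0 := congrFun h (0, 0)
  have h1 := congrFun h (0, 1)
  rw [exampleStates_apply] at h0 h1
  fin_cases i <;> simp [exampleCoeff] at h0 h1

theorem pairwiseOrthogonal_exampleStates : PairwiseOrthogonal exampleStates := by
  intro i j hij
  simp only [dotProduct, Pi.star_apply, exampleStates_apply, Fintype.sum_prod_type]
  fin_cases i <;> fin_cases j <;>
    first | exact absurd rfl hij | simp [exampleCoeff, Fin.sum_univ_succ]

/-- The partial trace, for integer coefficients. -/
def intReducedState {S : Type} [DecidableEq S] {d : S → ℕ} (D : Finset S)
    (ψ : ((s : S) → Fin (d s)) → ℤ) :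
    Matrix ((s : {s // s ∉ D}) → Fin (d s)) ((s : {s // s ∉ D}) → Fin (d s)) ℤ :=
  fun x y => ∑ z : (s : {s // s ∈ D}) → Fin (d s), ψ (glueLabels D x z) * ψ (glueLabels D y z)

theorem reducedState_intCast {S : Type} [DecidableEq S] {d : S → ℕ} (D : Finset S)
    (ψ : ((s : S) → Fin (d s)) → ℤ) :
    reducedState D (fun x => (ψ x : ℂ)) = (intReducedState D ψ).map (Int.castRingHom ℂ) := by
  ext x y
  simp [reducedState, intReducedState]

/-- Only six sets `D` occur, and over `ℤ` the traces can be evaluated by the kernel. -/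
theorem exists_trace_intReducedState_ne_zero : ∀ D : Finset (Fin 3), D.Nonempty →
    D ≠ Finset.univ → ∃ i j : Fin 3, i ≠ j ∧
      (intReducedState D (fun x => exampleCoeff i (qubitDecomposition.symm x).1
        (qubitDecomposition.symm x).2) *
      intReducedState D (fun x => exampleCoeff j (qubitDecomposition.symm x).1
        (qubitDecomposition.symm x).2)).trace ≠ 0 := by
  decide +kernel

theorem not_hasLocalRedundancy_exampleStates :
    ¬ HasLocalRedundancy qubitDecomposition exampleStates := by
  rintro ⟨D, hne, huniv, h⟩
  obtain ⟨i, j, hij, htr⟩ := exists_trace_intReducedState_ne_zero D hne huniv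
  refine htr ?_
  have h' := h i j hij
  simp only [exampleStates_apply] at h'
  rw [reducedState_intCast D (fun x => exampleCoeff i (qubitDecomposition.symm x).1
      (qubitDecomposition.symm x).2),
    reducedState_intCast D (fun x => exampleCoeff j (qubitDecomposition.symm x).1
      (qubitDecomposition.symm x).2), ← Matrix.map_mul, ← AddMonoidHom.map_trace] at h'
  simpa using h'

/-! ### The one-way protocol. -/

/-- Kraus operators of the measurement of Bob in the basis `|0⟩ ± |2⟩`, `|1⟩ ± |3⟩`. -/
noncomputable def bobKraus : Fin 4 → Matrix (Fin 2) (Fin 4) ℂ :=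
  -- Doubling the row gives the same rank-one effect as a single row with entries `±1/√2`, but with
  -- rational entries.
  ![!![1/2, 0, 1/2, 0; 1/2, 0, 1/2, 0], !![1/2, 0, -1/2, 0; 1/2, 0, -1/2, 0],
    !![0, 1/2, 0, 1/2; 0, 1/2, 0, 1/2], !![0, 1/2, 0, -1/2; 0, 1/2, 0, -1/2]]

theorem bobKraus_complete : ∑ k, (bobKraus k)ᴴ * bobKraus k = 1 := by
  ext i j
  fin_cases i <;> fin_cases j <;>
    simp [bobKraus, Fin.sum_univ_four, Matrix.mul_apply] <;> norm_num [Complex.conj_ofNat]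

/-- Kraus operators of the measurement of Alice in the computational basis. -/
def aliceKraus : Fin 2 → Matrix (Fin 1) (Fin 2) ℂ := ![!![1, 0], !![0, 1]]

theorem aliceKraus_complete : ∑ k, (aliceKraus k)ᴴ * aliceKraus k = 1 := by
  ext i j
  fin_cases i <;> fin_cases j <;> simp [aliceKraus, Matrix.mul_apply]

theorem locallyDistinguishable_exampleStates : LocallyDistinguishable exampleStates := by
  refine ⟨.bob 4 (fun _ => 2) bobKraus bobKraus_complete fun k =>
    .alice 2 (fun _ => 1) aliceKraus aliceKraus_complete fun l =>
      -- Outcomes `|0⟩ - |2⟩` and `|1⟩ + |3⟩` occur only for the state `1`; after the other two,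
      -- Alice's bit separates the states `0` and `2`.
      .announce ((![![0, 2], ![1, 1], ![1, 1], ![2, 0]] : Fin 4 → Fin 2 → Fin 3) k l), ?_⟩
  intro i
  simp only [LOCCProtocol.weight, vecNormSq, Fintype.sum_prod_type, aliceAct_apply, bobAct_apply,
    exampleStates_apply]
  simp only [Fin.sum_univ_four, Fin.sum_univ_two, Fin.sum_univ_one]
  fin_cases i <;> simp [aliceKraus, bobKraus, exampleCoeff] <;> norm_num

/-! ### Bob's projective measurement and the activated nonlocality. -/

theorem bobAct_bobProj_apply {m : ℕ} {i j : Fin 4} (hij : i ≠ j) (ψ : BipartiteVec m 4)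
    (a : Fin m) (b : Fin 4) :
    bobAct (bobProj i j) ψ (a, b) = if b = i ∨ b = j then ψ (a, b) else 0 := by
  rw [bobAct_apply]
  by_cases h1 : b = i
  · subst h1
    simp [bobProj, Matrix.single_apply, hij.symm]
  · by_cases h2 : b = j
    · subst h2
      simp [bobProj, Matrix.single_apply, hij]
    · simp [bobProj, h1, h2, Ne.symm h1, Ne.symm h2]

theorem isStarProjection_bobProj {i j : Fin 4} (hij : i ≠ j) :
    IsStarProjection (bobProj i j) := by
  constructor
  · simp [IsIdempotentElem, bobProj, add_mul, mul_add, hij, hij.symm]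
  · simp [IsSelfAdjoint, bobProj, Matrix.star_eq_conjTranspose]

/-- Unitary coefficient matrices of the three states after either outcome of Bob. -/
noncomputable def postMatrix : Fin 2 → Fin 3 → Matrix (Fin 2) (Fin 2) ℂ :=
  ![![!![1, 0; 0, 1], !![1, 0; 0, -1], !![0, 1; -1, 0]],
    ![!![1, 0; 0, -1], !![-1, 0; 0, -1], !![0, -1; -1, 0]]]

theorem postMatrix_mul_conjTranspose (μ : Fin 2) (i : Fin 3) :
    postMatrix μ i * (postMatrix μ i)ᴴ = 1 := by
  ext a b
  fin_cases μ <;> fin_cases i <;> fin_cases a <;> fin_cases b <;>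
    simp [postMatrix, Matrix.mul_apply, Fin.sum_univ_two]

/-- The isometry of `ℂ²` onto the range of the projector of Bob with outcome `μ`. -/
def bobIsometry : Fin 2 → Matrix (Fin 4) (Fin 2) ℂ :=
  ![!![1, 0; 0, 1; 0, 0; 0, 0], !![0, 0; 0, 0; 1, 0; 0, 1]]

theorem bobIsometry_conjTranspose_mul (μ : Fin 2) : (bobIsometry μ)ᴴ * bobIsometry μ = 1 := by
  ext a b
  fin_cases μ <;> fin_cases a <;> fin_cases b <;>
    simp [bobIsometry, Matrix.mul_apply, Fin.sum_univ_succ]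

theorem bobAct_bobMeasurement_exampleStates (μ : Fin 2) (i : Fin 3) :
    bobAct (bobMeasurement.K μ) (exampleStates i) =
      matrixVec ((1 : Matrix (Fin 2) (Fin 2) ℂ) * postMatrix μ i * (bobIsometry μ)ᵀ) := by
  ext ⟨a, b⟩
  rw [Matrix.one_mul]
  fin_cases μ
  · refine (bobAct_bobProj_apply (i := 0) (j := 1) (by decide) _ a b).trans ?_
    rw [exampleStates_apply]
    fin_cases i <;> fin_cases a <;> fin_cases b <;>
      simp [exampleCoeff, matrixVec, postMatrix, bobIsometry, Matrix.mul_apply, Fin.sum_univ_two]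
  · refine (bobAct_bobProj_apply (i := 2) (j := 3) (by decide) _ a b).trans ?_
    rw [exampleStates_apply]
    fin_cases i <;> fin_cases a <;> fin_cases b <;>
      simp [exampleCoeff, matrixVec, postMatrix, bobIsometry, Matrix.mul_apply, Fin.sum_univ_two]

theorem not_locallyDistinguishable_postMeasurement (μ : Fin 2) :
    ¬ LocallyDistinguishable (fun i => bobAct (bobMeasurement.K μ) (exampleStates i)) := by
  simp only [bobAct_bobMeasurement_exampleStates]
  exact not_locallyDistinguishable_of_maximallyEntangled (by norm_num) (by norm_num) (by simp)
    (bobIsometry_conjTranspose_mul μ) _ (postMatrix_mul_conjTranspose μ)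

theorem pairwiseOrthogonal_postMeasurement (μ : Fin 2) :
    PairwiseOrthogonal (fun i => bobAct (bobMeasurement.K μ) (exampleStates i)) := by
  intro i j hij
  simp only [bobAct_bobMeasurement_exampleStates, Matrix.one_mul, dotProduct, Pi.star_apply,
    Fintype.sum_prod_type]
  fin_cases μ <;> fin_cases i <;> fin_cases j <;>
    first
    | exact absurd rfl hij
    | simp [matrixVec, postMatrix, bobIsometry, Matrix.mul_apply, Fin.sum_univ_succ]

theorem isEntangledVec_postMeasurement (μ : Fin 2) (i : Fin 3) :
    IsEntangledVec (bobAct (bobMeasurement.K μ) (exampleStates i)) := by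
  rw [bobAct_bobMeasurement_exampleStates, Matrix.one_mul]
  -- On the two columns of the outcome, the minor is the determinant of the unitary `postMatrix μ
  -- i`.
  refine isEntangledVec_of_minor_ne_zero 0 1
    ((![0, 2] : Fin 2 → Fin 4) μ) ((![1, 3] : Fin 2 → Fin 4) μ) ?_
  fin_cases μ <;> fin_cases i <;>
    simp [matrixVec, postMatrix, bobIsometry, Matrix.mul_apply, Fin.sum_univ_two]

theorem IsEntangledVec.ne_zero {m n : ℕ} {φ : BipartiteVec m n} (h : IsEntangledVec φ) :
    φ ≠ 0 := by
  rintro rfl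
  exact h ⟨0, 0, by ext; simp⟩

theorem matrixVec_mul_mul_transpose {m n k l : ℕ} (V : Matrix (Fin m) (Fin k) ℂ)
    (X : Matrix (Fin k) (Fin l) ℂ) (W : Matrix (Fin n) (Fin l) ℂ) :
    matrixVec (V * X * Wᵀ) = (V ⊗ₖ W) *ᵥ matrixVec X := by
  ext ⟨a, b⟩
  simp only [matrixVec, Matrix.mul_apply, Matrix.mulVec, dotProduct, Fintype.sum_prod_type,
    Matrix.kroneckerMap_apply, Matrix.transpose_apply, Finset.sum_mul]
  rw [Finset.sum_comm]
  exact Finset.sum_congr rfl fun _ _ => Finset.sum_congr rfl fun _ _ => by ring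

theorem lieInTwoQubitSubspace_postMeasurement (μ : Fin 2) :
    LieInTwoQubitSubspace (fun i => bobAct (bobMeasurement.K μ) (exampleStates i)) :=
  ⟨1, bobIsometry μ, by simp, bobIsometry_conjTranspose_mul μ, fun i =>
    ⟨matrixVec (postMatrix μ i), by
      simp only [bobAct_bobMeasurement_exampleStates, matrixVec_mul_mul_transpose]⟩⟩

theorem bobMeasurement_nontrivial : bobMeasurement.Nontrivial := by
  intro h
  obtain ⟨c, hc⟩ := h (0 : Fin 2)
  have hp : (bobProj 0 1)ᴴ * bobProj 0 1 = bobProj 0 1 := by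
    have := isStarProjection_bobProj (i := 0) (j := 1) (by decide)
    rw [← Matrix.star_eq_conjTranspose, this.isSelfAdjoint.star_eq, this.isIdempotentElem.eq]
  replace hc : bobProj 0 1 = c • (1 : Matrix (Fin 4) (Fin 4) ℂ) := hp.symm.trans hc
  -- These diagonal entries would force both `c = 1` and `c = 0`.
  have h0 := congrFun (congrFun hc 0) 0
  have h2 := congrFun (congrFun hc 2) 2
  simp [bobProj] at h0 h2
  exact one_ne_zero (h0.trans h2.symm)

theorem hasGenuineActivableNonlocality_exampleStates :
    HasGenuineActivableNonlocality qubitDecomposition exampleStates :=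
  ⟨exampleStates_ne_zero, pairwiseOrthogonal_exampleStates, not_hasLocalRedundancy_exampleStates,
    locallyDistinguishable_exampleStates, Or.inr ⟨bobMeasurement, bobMeasurement_nontrivial,
      fun μ => ⟨fun i => (isEntangledVec_postMeasurement μ i).ne_zero,
        pairwiseOrthogonal_postMeasurement μ, not_locallyDistinguishable_postMeasurement μ⟩⟩⟩

theorem mainTheorem1 :
    -- three orthogonal states, without local redundancy and locally distinguishable
    (∀ i, exampleStates i ≠ 0) ∧
    PairwiseOrthogonal exampleStates ∧
    ¬ HasLocalRedundancy qubitDecomposition exampleStates ∧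
    LocallyDistinguishable exampleStates ∧
    -- the measurement of Bob is a projective measurement
    (∀ μ, IsStarProjection (bobMeasurement.K μ)) ∧
    -- the states after the outcome `P₀₁`
    (bobAct (bobProj 0 1) (exampleStates 0) = ket 0 0 + ket 1 1 ∧
      bobAct (bobProj 0 1) (exampleStates 1) = ket 0 0 - ket 1 1 ∧
      bobAct (bobProj 0 1) (exampleStates 2) = ket 0 1 - ket 1 0) ∧
    -- the states after the outcome `P₂₃`
    (bobAct (bobProj 2 3) (exampleStates 0) = ket 0 2 - ket 1 3 ∧
      bobAct (bobProj 2 3) (exampleStates 1) = -(ket 0 2 + ket 1 3) ∧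
      bobAct (bobProj 2 3) (exampleStates 2) = -(ket 1 2 + ket 0 3)) ∧
    -- for either outcome: three orthogonal entangled states in a `ℂ² ⊗ ℂ²` subspace, which
    -- cannot be perfectly distinguished by LOCC
    (∀ μ,
      (∀ i, bobAct (bobMeasurement.K μ) (exampleStates i) ≠ 0) ∧
      PairwiseOrthogonal (fun i => bobAct (bobMeasurement.K μ) (exampleStates i)) ∧
      (∀ i, IsEntangledVec (bobAct (bobMeasurement.K μ) (exampleStates i))) ∧
      LieInTwoQubitSubspace (fun i => bobAct (bobMeasurement.K μ) (exampleStates i)) ∧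
      ¬ LocallyDistinguishable (fun i => bobAct (bobMeasurement.K μ) (exampleStates i))) ∧
    -- hence genuine activable nonlocality
    HasGenuineActivableNonlocality qubitDecomposition exampleStates := by
  refine ⟨exampleStates_ne_zero, pairwiseOrthogonal_exampleStates,
    not_hasLocalRedundancy_exampleStates, locallyDistinguishable_exampleStates, ?_, ?_, ?_,
    fun μ => ⟨fun i => (isEntangledVec_postMeasurement μ i).ne_zero,
      pairwiseOrthogonal_postMeasurement μ, isEntangledVec_postMeasurement μ,
      lieInTwoQubitSubspace_postMeasurement μ, not_locallyDistinguishable_postMeasurement μ⟩,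
    hasGenuineActivableNonlocality_exampleStates⟩
  · change ∀ μ : Fin 2, IsStarProjection (![bobProj 0 1, bobProj 2 3] μ)
    rw [Fin.forall_fin_two]
    exact ⟨isStarProjection_bobProj (by decide), isStarProjection_bobProj (by decide)⟩
  all_goals
    refine ⟨?_, ?_, ?_⟩ <;> ext ⟨a, b⟩ <;>
      rw [bobAct_bobProj_apply (by decide), exampleStates_apply] <;>
      fin_cases a <;> fin_cases b <;> simp [exampleCoeff, ket]
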